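/- Digraphs here have no parallel arcs, but loops are allowed. A digraph is called $\mathscr{F}_k$-free if it does not contain two different walks of length $k$ with the same initial vertex and the same terminal vertex (vertices and arcs may be repeated in a walk). Let $ex(n,\mathscr{F}_k)$ be the maximum number of arcs of an $\mathscr{F}_k$-free digraph on $n$ vertices, and let $Ex(n,\mathscr{F}_k)$ be the set of $\mathscr{F}_k$-free digraphs on $n$ vertices with exactly $ex(n,\mathscr{F}_k)$ arcs. Let $T_k$ be the $k\times k$ matrix with $(i,j)$ entry $1$ if $i<j$ and $0$ otherwise, and let $J_2$ be the $2\times 2$ all-ones matrix, so that $$J_2\otimes T_k=\begin{bmatrix}T_k&T_k\\T_k&T_k\end{bmatrix}.$$ For $k\ge 5$, a digraph on $k+5$ vertices is called a $(1,k,5)$-completely transitive tournament if, for some $\alpha\subseteq\{k+1,\dots,2k\}$ with $|\alpha|=k-5$, its adjacency matrix is permutation similar (that is, equal up to a simultaneous permutation of rows and columns) to the principal submatrix of $J_2\otimes T_k$ obtained by deleting the rows and columns with indices in $\alpha$. (For $k=5$ nothing is deleted.) **Lemma.** Let $n\ge 10$ be an integer. Then $$ex(n,\mathscr{F}_{n-5})=\frac{n(n-1)}{2}-5.$$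 Moreover, a digraph $D$ on $n$ vertices is in $Ex(n,\mathscr{F}_{n-5})$ if and only if $D$ is a $(1,n-5,5)$-completely transitive tournament. -/

import Mathlib

open scoped Kronecker

/-! Digraphs are Mathlib's `Digraph`: no parallel arcs, loops allowed. -/

namespace TuranWalk

/-- A walk of length `k` in `D`, given by its sequence of `k + 1` vertices (repetitions allowed):
consecutive vertices are joined by an arc. -/
def IsWalk {V : Type*} (D : Digraph V) {k : ℕ} (p : Fin (k + 1) → V) : Prop :=
  ∀ i : Fin k, D.Adj (p i.castSucc) (p i.succ)

/-- `D` is `𝓕_k`-free: `D` does not contain two different walks of length `k` with the same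
initial vertex and the same terminal vertex. -/
def IsFree {V : Type*} (D : Digraph V) (k : ℕ) : Prop :=
  ¬ ∃ p q : Fin (k + 1) → V, IsWalk D p ∧ IsWalk D q ∧
      p 0 = q 0 ∧ p (Fin.last k) = q (Fin.last k) ∧ p ≠ q

/-- The size of a digraph: its number of arcs (loops included). -/
noncomputable def size {V : Type*} (D : Digraph V) : ℕ :=
  Set.ncard {a : V × V | D.Adj a.1 a.2}

/-- `ex n k` is the maximum size of an `𝓕_k`-free digraph of order `n`. -/
noncomputable def ex (n k : ℕ) : ℕ :=
  sSup {m : ℕ | ∃ D : Digraph (Fin n), IsFree D k ∧ size D = m}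

/-- `Ex n k` is the set of `𝓕_k`-free digraphs on `n` vertices of size `ex n k`. -/
def Ex (n k : ℕ) : Set (Digraph (Fin n)) :=
  {D | IsFree D k ∧ size D = ex n k}

/-- The supremum defining `ex n k` is an attained maximum. -/
theorem isGreatest_ex (n k : ℕ) :
    IsGreatest {m : ℕ | ∃ D : Digraph (Fin n), IsFree D k ∧ size D = m} (ex n k) := by
  have hb : BddAbove {m : ℕ | ∃ D : Digraph (Fin n), IsFree D k ∧ size D = m} := by
    refine ⟨Nat.card (Fin n × Fin n), ?_⟩
    rintro m ⟨D, -, rfl⟩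
    exact Set.ncard_le_card _
  have hne : {m : ℕ | ∃ D : Digraph (Fin n), IsFree D k ∧ size D = m}.Nonempty := by
    refine ⟨_, ⟨fun _ _ => False⟩, ?_, rfl⟩
    rintro ⟨p, q, hp, -, h0, -, hne⟩
    cases k with
    | zero =>
      refine hne (funext fun i => ?_)
      have hi : i = 0 := by ext; omega
      rw [hi, h0]
    | succ k => exact hp 0
  exact ⟨Nat.sSup_mem hne hb, fun m hm => le_csSup hb hm⟩

open Classical in
/-- The adjacency matrix of a digraph. -/
noncomputable def adjMatrix {V : Type*} (D : Digraph V) : Matrix V V ℕ :=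
  Matrix.of fun i j => if D.Adj i j then 1 else 0

/-- `T n`: the `n × n` upper triangular tournament matrix. -/
def T (n : ℕ) : Matrix (Fin n) (Fin n) ℕ :=
  Matrix.of fun i j => if i < j then 1 else 0

/-- `J n`: the `n × n` all-ones matrix. -/
def J (n : ℕ) : Matrix (Fin n) (Fin n) ℕ :=
  Matrix.of fun _ _ => 1

/-- `Pi' m n = J m ⊗ T n`; the index `(i, j)` is position `j` in block `i`. -/
def Pi' (m n : ℕ) : Matrix (Fin m × Fin n) (Fin m × Fin n) ℕ :=
  J m ⊗ₖ T n

/-- The indices of `Pi' (m + 1) n` that remain when the positions `α` of the last block are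
deleted. -/
abbrev Remaining (m n : ℕ) (α : Finset (Fin n)) : Type :=
  {x : Fin (m + 1) × Fin n // ¬ (x.1 = Fin.last m ∧ x.2 ∈ α)}

/-- The principal submatrix of `Pi' (m + 1) n` obtained by deleting the rows and columns at the
positions `α` of the last block. -/
def deleted (m n : ℕ) (α : Finset (Fin n)) :
    Matrix (Remaining m n α) (Remaining m n α) ℕ :=
  (Pi' (m + 1) n).submatrix Subtype.val Subtype.val

/-- Two square matrices are permutation similar: one is obtained from the other by a simultaneous
bijective relabelling of rows and columns. -/
def PermSimilar {ι κ : Type*} (A : Matrix ι ι ℕ) (B : Matrix κ κ ℕ) : Prop :=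
  ∃ e : ι ≃ κ, A = B.submatrix e e

/-- `D` is an `(m, n, t)`-completely transitive tournament: its adjacency matrix is permutation
similar to `J (m + 1) ⊗ T n` with `n - t` positions of the last block deleted. The
condition `α.card + t = n` says `t ≤ n` and `α.card = n - t`; for `t = n` nothing is deleted. -/
def IsCompletelyTransitive {V : Type*} (D : Digraph V) (m n t : ℕ) : Prop :=
  ∃ α : Finset (Fin n), α.card + t = n ∧ PermSimilar (adjMatrix D) (deleted m n α)

end TuranWalk

/-! Write `k = n - 5`. Summing `slack` over ordered pairs gives `n (n - 1) - 2 * size D`, so the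
bound says that the total slack of an `𝓕_k`-free digraph is at least 10, and extremal digraphs are
those with total slack exactly 10. Three cases give the bound (`IsFree.ten_le_sum_slack`).

If `D` has a closed walk, take as core `K` the vertices on loops and 2-cycles or, if there are none,
those of a shortest cycle. Walks ending in `K` can be prolonged inside `K`, so freeness already
forbids two short walks with common ends there. This makes `K` sparse and forces many non-adjacent
pairs around it: the slack is at least `2 (n - 4) ≥ 12` (`IsCycleCore.le_sum_slack`).

If `D` is acyclic with a walk of length at least `k`, comparing a longest path with its detours
gives slack at least 12 (`IsLevel.le_sum_slack`).

If `D` is acyclic without such a walk, the length of a longest walk ending at a vertex sorts the `k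
+ 5` vertices into `k` independent layers. Layers of sizes `a i` cost at least `∑ a i (a i - 1) ≥ ∑
2 (a i - 1) = 10`. Equality means that every layer has one or two vertices and that all pairs in
different layers are joined upwards, which is a completely transitive tournament
(`isLayering_of_sum_slack_le`, `isCompletelyTransitive_iff`). -/

namespace TuranWalk

open Finset

/-! ### Prolonging short walks to length `k`. -/

section Walks

variable {V : Type*} {D : Digraph V}

theorem isWalk_snoc {k : ℕ} {p : Fin (k + 1) → V} (hp : IsWalk D p) {b : V}
    (hb : D.Adj (p (Fin.last k)) b) : IsWalk D (Fin.snoc p b : Fin (k + 2) → V) := by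
  intro i
  refine Fin.lastCases ?_ (fun j => ?_) i
  · rw [Fin.succ_last, Fin.snoc_last, Fin.snoc_castSucc]
    exact hb
  · rw [Fin.snoc_castSucc, Fin.succ_castSucc, Fin.snoc_castSucc]
    exact hp j

theorem isWalk_cons {k : ℕ} {p : Fin (k + 1) → V} (hp : IsWalk D p) {a : V}
    (ha : D.Adj a (p 0)) : IsWalk D (Fin.cons a p : Fin (k + 2) → V) := by
  intro i
  refine Fin.cases ?_ (fun j => ?_) i
  · rw [Fin.castSucc_zero, Fin.cons_zero, Fin.cons_succ]
    exact ha
  · rw [Fin.cons_succ, ← Fin.succ_castSucc, Fin.cons_succ]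
    exact hp j

/-- In an `𝓕_k`-free digraph, shorter walks ending in a set that can be followed forever are
determined by their ends. -/
theorem IsFree.eq_of_last_mem {k : ℕ} (h : IsFree D k) {K : Set V}
    (hK : ∀ x ∈ K, ∃ y ∈ K, D.Adj x y) {m : ℕ} (hm : m ≤ k) :
    ∀ {p q : Fin (m + 1) → V}, IsWalk D p → IsWalk D q → p 0 = q 0 →
      p (Fin.last m) = q (Fin.last m) → p (Fin.last m) ∈ K → p = q := by
  induction hm using Nat.decreasingInduction with
  | self =>
    intro p q hp hq h0 hl _
    by_contra hne
    exact h ⟨p, q, hp, hq, h0, hl, hne⟩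
  | of_succ m hm ih =>
    intro p q hp hq h0 hl hmem
    obtain ⟨b, hb, hab⟩ := hK _ hmem
    have := ih (isWalk_snoc hp hab) (isWalk_snoc hq (hl ▸ hab))
      (by rw [← Fin.castSucc_zero, Fin.snoc_castSucc, Fin.snoc_castSucc, h0])
      (by rw [Fin.snoc_last, Fin.snoc_last]) (by rw [Fin.snoc_last]; exact hb)
    funext i
    have := congrFun this i.castSucc
    rwa [Fin.snoc_castSucc, Fin.snoc_castSucc] at this

/-- In an `𝓕_k`-free digraph, shorter walks starting in a set that can be traced back forever are
determined by their ends. -/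
theorem IsFree.eq_of_zero_mem {k : ℕ} (h : IsFree D k) {K : Set V}
    (hK : ∀ y ∈ K, ∃ x ∈ K, D.Adj x y) {m : ℕ} (hm : m ≤ k) :
    ∀ {p q : Fin (m + 1) → V}, IsWalk D p → IsWalk D q → p 0 = q 0 →
      p (Fin.last m) = q (Fin.last m) → p 0 ∈ K → p = q := by
  induction hm using Nat.decreasingInduction with
  | self =>
    intro p q hp hq h0 hl _
    by_contra hne
    exact h ⟨p, q, hp, hq, h0, hl, hne⟩
  | of_succ m hm ih =>
    intro p q hp hq h0 hl hmem
    obtain ⟨a, ha, hab⟩ := hK _ hmem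
    have := ih (isWalk_cons hp hab) (isWalk_cons hq (h0 ▸ hab))
      (by rw [Fin.cons_zero, Fin.cons_zero])
      (by rw [← Fin.succ_last, Fin.cons_succ, Fin.cons_succ, hl])
      (by rw [Fin.cons_zero]; exact ha)
    funext i
    have := congrFun this i.succ
    rwa [Fin.cons_succ, Fin.cons_succ] at this

/-- Freeness for sequences indexed by `ℕ`, of which only the terms up to `k` matter; detours from a
path are easier to write this way than on `Fin (k + 1)`. -/
theorem IsFree.eq_of_seq {k : ℕ} (h : IsFree D k) {f g : ℕ → V}
    (hf : ∀ i < k, D.Adj (f i) (f (i + 1))) (hg : ∀ i < k, D.Adj (g i) (g (i + 1)))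
    (h0 : f 0 = g 0) (hl : f k = g k) {i : ℕ} (hi : i ≤ k) : f i = g i := by
  by_contra hne
  refine h ⟨fun j => f j, fun j => g j, fun j => ?_, fun j => ?_, h0, hl, fun he => hne ?_⟩
  · simpa using hf j j.2
  · simpa using hg j j.2
  · exact congrFun he ⟨i, by omega⟩

end Walks

/-! ### Counting missing arcs over ordered pairs. -/

section Slack

variable {V : Type*}

open Classical in
/-- The indicator of an arc. -/
noncomputable def arc (D : Digraph V) (u v : V) : ℤ := if D.Adj u v then 1 else 0

open Classical in
/-- The number of arcs that the pair `u, v` has less than in a tournament; a loop is counted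
twice. -/
noncomputable def slack (D : Digraph V) (u v : V) : ℤ :=
  (if u = v then 0 else 1) - arc D u v - arc D v u

theorem slack_comm (D : Digraph V) (u v : V) : slack D u v = slack D v u := by
  unfold slack
  by_cases h : u = v
  · rw [h]
  · rw [if_neg h, if_neg (Ne.symm h)]
    ring

/-- Only loops (slack `-2`) and 2-cycles (slack `-1`) are negative; for `u = v` the hypothesis
excludes the loop. -/
theorem slack_nonneg {D : Digraph V} {u v : V} (h : D.Adj u v → ¬ D.Adj v u) :
    0 ≤ slack D u v := by
  unfold slack arc
  by_cases huv : u = v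
  · subst huv
    have : ¬ D.Adj u u := fun h' => h h' h'
    simp [this]
  · by_cases h1 : D.Adj u v
    · simp [huv, h1, h h1]
    · by_cases h2 : D.Adj v u <;> simp [huv, h1, h2]

theorem slack_eq_one {D : Digraph V} {u v : V} (hne : u ≠ v) (h1 : ¬ D.Adj u v)
    (h2 : ¬ D.Adj v u) : slack D u v = 1 := by
  simp [slack, arc, hne, h1, h2]

theorem sum_arc [Fintype V] (D : Digraph V) : ∑ u, ∑ v, arc D u v = size D := by
  classical
  rw [← Fintype.sum_prod_type' (f := fun u v => arc D u v)]
  unfold arc size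
  rw [Set.ncard_eq_toFinset_card', Finset.sum_boole]
  congr 2
  ext
  simp

theorem sum_ne [DecidableEq V] (K : Finset V) :
    ∑ u ∈ K, ∑ v ∈ K, (if u = v then 0 else 1 : ℤ) = #K * (#K - 1) := by
  have : ∀ u ∈ K, ∑ v ∈ K, (if u = v then 0 else 1 : ℤ) = #K - 1 := by
    intro u hu
    have h : ∀ v, (if u = v then 0 else 1 : ℤ) = 1 - if u = v then 1 else 0 := by
      intro v; split_ifs <;> simp
    simp [h, hu]
  rw [Finset.sum_congr rfl this, Finset.sum_const, nsmul_eq_mul]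

theorem sum_slack_finset (D : Digraph V) (K : Finset V) :
    ∑ u ∈ K, ∑ v ∈ K, slack D u v = #K * (#K - 1) - 2 * ∑ u ∈ K, ∑ v ∈ K, arc D u v := by
  classical
  unfold slack
  simp only [Finset.sum_sub_distrib]
  rw [Finset.sum_comm (f := fun u v => arc D v u), ← sum_ne K]
  ring

theorem sum_slack [Fintype V] (D : Digraph V) :
    ∑ u, ∑ v, slack D u v = (Fintype.card V : ℤ) * (Fintype.card V - 1) - 2 * size D := by
  rw [sum_slack_finset, sum_arc, Finset.card_univ]

theorem sum_slack_split [Fintype V] [DecidableEq V] (D : Digraph V) (K : Finset V) :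
    ∑ u, ∑ v, slack D u v = ∑ u ∈ K, ∑ v ∈ K, slack D u v
      + 2 * ∑ w ∈ Kᶜ, ∑ x ∈ K, slack D w x + ∑ w ∈ Kᶜ, ∑ v ∈ Kᶜ, slack D w v := by
  rw [← Finset.sum_add_sum_compl K]
  simp only [← Finset.sum_add_sum_compl K (fun v => slack D _ v), Finset.sum_add_distrib]
  have : ∑ x ∈ K, ∑ w ∈ Kᶜ, slack D x w = ∑ w ∈ Kᶜ, ∑ x ∈ K, slack D w x := by
    rw [Finset.sum_comm]
    simp only [slack_comm D]
  rw [this]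
  ring

/-- `E` consists of ordered pairs, so a non-adjacent pair listed in both orders contributes 2. -/
theorem card_le_sum_slack {D : Digraph V} {W : Finset V}
    (hW : ∀ u ∈ W, ∀ v ∈ W, D.Adj u v → ¬ D.Adj v u) {E : Finset (V × V)}
    (hE : ∀ e ∈ E, e.1 ∈ W ∧ e.2 ∈ W ∧ e.1 ≠ e.2 ∧ ¬ D.Adj e.1 e.2 ∧ ¬ D.Adj e.2 e.1) :
    (#E : ℤ) ≤ ∑ u ∈ W, ∑ v ∈ W, slack D u v := by
  rw [← Finset.sum_product']
  calc (#E : ℤ) = ∑ e ∈ E, slack D e.1 e.2 := by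
        rw [Finset.sum_congr rfl (fun e he => slack_eq_one (hE e he).2.2.1 (hE e he).2.2.2.1
          (hE e he).2.2.2.2)]
        simp
    _ ≤ _ := by
        refine Finset.sum_le_sum_of_subset_of_nonneg ?_ ?_
        · intro e he
          exact Finset.mem_product.2 ⟨(hE e he).1, (hE e he).2.1⟩
        · intro e he _
          rw [Finset.mem_product] at he
          exact slack_nonneg (hW _ he.1 _ he.2)

theorem card_le_sum_slack_right {D : Digraph V} {w : V} {X A : Finset V} (hA : A ⊆ X)
    (hX : ∀ x ∈ X, D.Adj w x → ¬ D.Adj x w)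
    (hna : ∀ x ∈ A, w ≠ x ∧ ¬ D.Adj w x ∧ ¬ D.Adj x w) :
    (#A : ℤ) ≤ ∑ x ∈ X, slack D w x := by
  calc (#A : ℤ) = ∑ x ∈ A, slack D w x := by
        rw [Finset.sum_congr rfl (fun x hx => slack_eq_one (hna x hx).1 (hna x hx).2.1
          (hna x hx).2.2)]
        simp
    _ ≤ _ := Finset.sum_le_sum_of_subset_of_nonneg hA fun x hx _ => slack_nonneg (hX x hx)

end Slack

/-! ### The slack forced by a cyclic core. -/

section Core

variable {V : Type*}

/-- A set of vertices in which every vertex has a unique out-neighbour and an in-neighbour, and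
which restricts the arcs around it as the loops and `2`-cycles, or a shortest cycle, of an
`𝓕_k`-free digraph does. -/
structure IsCycleCore (D : Digraph V) (K : Finset V) : Prop where
  nonempty : K.Nonempty
  exists_succ : ∀ x ∈ K, ∃ y ∈ K, D.Adj x y
  exists_pred : ∀ y ∈ K, ∃ x ∈ K, D.Adj x y
  succ_unique : ∀ x ∈ K, ∀ y ∈ K, ∀ z ∈ K, D.Adj x y → D.Adj x z → y = z
  asymm : ∀ w ∉ K, ∀ v, D.Adj w v → ¬ D.Adj v w
  adj_in : ∀ w ∉ K, ∀ v ∉ K, D.Adj w v → ∀ x ∈ K, ∀ y ∈ K, D.Adj x y → D.Adj w x → ¬ D.Adj v y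
  adj_out : ∀ w ∉ K, ∀ v ∉ K, D.Adj w v → ∀ x ∈ K, ∀ y ∈ K, D.Adj x y → D.Adj x w → ¬ D.Adj y v
  full : ∀ w ∉ K, (∀ x ∈ K, D.Adj w x ∨ D.Adj x w) →
    (∀ x ∈ K, D.Adj w x) ∨ (∀ x ∈ K, D.Adj x w)

variable {D : Digraph V} {K : Finset V}

theorem IsCycleCore.le_sum_slack_self (h : IsCycleCore D K) :
    (#K : ℤ) * (#K - 3) ≤ ∑ x ∈ K, ∑ y ∈ K, slack D x y := by
  classical
  rw [sum_slack_finset]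
  have : ∑ x ∈ K, ∑ y ∈ K, arc D x y ≤ ∑ x ∈ K, 1 := by
    refine Finset.sum_le_sum fun x hx => ?_
    unfold arc
    rw [Finset.sum_boole]
    have : #{y ∈ K | D.Adj x y} ≤ 1 := by
      rw [Finset.card_le_one]
      intro a ha b hb
      rw [Finset.mem_filter] at ha hb
      exact h.succ_unique x hx a ha.1 b hb.1 ha.2 hb.2
    exact_mod_cast this
  rw [Finset.sum_const, nsmul_eq_mul, mul_one] at this
  linarith

theorem IsCycleCore.slack_nonneg (h : IsCycleCore D K) {w : V} (hw : w ∉ K) (v : V) :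
    0 ≤ slack D w v :=
  TuranWalk.slack_nonneg (h.asymm w hw v)

/-- With `y' → x → y` in the core, an arc `w → z` would give `w → z → y` beside `w → x → y`, and an
arc `z → w` would give `z → w → x` beside `z → y' → x`. -/
theorem IsCycleCore.not_adj_of_full_in (h : IsCycleCore D K) {z w x : V} (hz : z ∉ K) (hw : w ∉ K)
    (hx : x ∈ K) (hwx : D.Adj w x) (hfz : ∀ y ∈ K, D.Adj z y) : ¬ D.Adj w z ∧ ¬ D.Adj z w := by
  obtain ⟨y, hy, hxy⟩ := h.exists_succ x hx
  obtain ⟨y', hy', hyx'⟩ := h.exists_pred x hx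
  exact ⟨fun hwz => h.adj_in w hw z hz hwz x hx y hy hxy hwx (hfz y hy),
    fun hzw => h.adj_in z hz w hw hzw y' hy' x hx hyx' (hfz y' hy') hwx⟩

theorem IsCycleCore.not_adj_of_full_out (h : IsCycleCore D K) {z w x : V} (hz : z ∉ K)
    (hw : w ∉ K) (hx : x ∈ K) (hwx : D.Adj x w) (hfz : ∀ y ∈ K, D.Adj y z) :
    ¬ D.Adj w z ∧ ¬ D.Adj z w := by
  obtain ⟨y, hy, hxy⟩ := h.exists_succ x hx
  obtain ⟨y', hy', hyx'⟩ := h.exists_pred x hx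
  exact ⟨fun hwz => h.adj_out w hw z hz hwz x hx y hy hxy hwx (hfz y hy),
    fun hzw => h.adj_out z hz w hw hzw y' hy' x hx hyx' (hfz y' hy') hwx⟩

/-- A vertex outside the core with at most one non-neighbour in it has no arcs to or from some
vertex that is adjacent to the whole core in the same direction. -/
theorem IsCycleCore.exists_twin (h : IsCycleCore D K) (h2 : 2 ≤ #K) {w : V}
    (hw : w ∉ K) (hm : ∑ x ∈ K, slack D w x ≤ 1) {zi zo : V} (hzi : zi ∉ K)
    (hfi : ∀ y ∈ K, D.Adj zi y) (hzo : zo ∉ K) (hfo : ∀ y ∈ K, D.Adj y zo) :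
    (¬ D.Adj w zi ∧ ¬ D.Adj zi w) ∨ (¬ D.Adj w zo ∧ ¬ D.Adj zo w) := by
  classical
  by_contra hcon
  -- Any arc between `w` and the core yields one of the two alternatives, so `w` would miss all of
  -- `K`, which costs at least 2.
  have hna : ∀ x ∈ K, ¬ D.Adj w x ∧ ¬ D.Adj x w := by
    intro x hx
    refine ⟨fun hwx => hcon (Or.inl ?_), fun hxw => hcon (Or.inr ?_)⟩
    · exact h.not_adj_of_full_in hzi hw hx hwx hfi
    · exact h.not_adj_of_full_out hzo hw hx hxw hfo
  have := card_le_sum_slack_right (D := D) (w := w) (subset_refl K)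
    (fun x _ => h.asymm w hw x) (fun x hx => ⟨fun e => hw (e ▸ hx), hna x hx⟩)
  have : (2 : ℤ) ≤ #K := by exact_mod_cast h2
  linarith

open Classical in
-- The vertices outside `K` split into `I` (arcs to all of `K`), `O` (arcs from all of `K`) and `U`
-- (some non-neighbour in `K`). `I` and `O` are independent, so the slack is at least `|K| (|K| - 3)
-- + 2 |U| + |I| (|I| - 1) + |O| (|O| - 1)`. As `a (a - 1) ≥ 2 (a - 1)`, this is at least `2 (n - 4)
-- + (|K| - 1) (|K| - 4)`.
theorem IsCycleCore.le_sum_slack [Fintype V] (h : IsCycleCore D K) (hV : 10 ≤ Fintype.card V) :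
    2 * ((Fintype.card V : ℤ) - 4) ≤ ∑ u, ∑ v, slack D u v := by
  rw [sum_slack_split D K]
  set I := Kᶜ.filter fun w => ∀ x ∈ K, D.Adj w x with hI
  set O := Kᶜ.filter fun w => ∀ x ∈ K, D.Adj x w with hO
  set U := Kᶜ.filter fun w => ∃ x ∈ K, ¬ D.Adj w x ∧ ¬ D.Adj x w with hU
  obtain ⟨x₀, hx₀⟩ := h.nonempty
  have hdisj : Disjoint I O := by
    rw [Finset.disjoint_left]
    intro w hwI hwO
    rw [Finset.mem_filter, Finset.mem_compl] at hwI hwO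
    exact h.asymm w hwI.1 x₀ (hwI.2 x₀ hx₀) (hwO.2 x₀ hx₀)
  have hdisjU : Disjoint (I ∪ O) U := by
    rw [Finset.disjoint_left]
    intro w hw hwU
    rw [Finset.mem_filter] at hwU
    obtain ⟨-, x, hx, h1, h2⟩ := hwU
    rcases Finset.mem_union.1 hw with hw | hw
    · exact h1 ((Finset.mem_filter.1 hw).2 x hx)
    · exact h2 ((Finset.mem_filter.1 hw).2 x hx)
  have hunion : (I ∪ O) ∪ U = Kᶜ := by
    ext w
    simp only [hI, hO, hU, Finset.mem_union, Finset.mem_filter, ← and_or_left, and_iff_left_iff_imp]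
    intro hw
    rw [Finset.mem_compl] at hw
    by_cases hf : ∃ x ∈ K, ¬ D.Adj w x ∧ ¬ D.Adj x w
    · exact Or.inr hf
    · push Not at hf
      exact Or.inl (h.full w hw fun x hx => or_iff_not_imp_left.2 (hf x hx))
  have hcard : #K + (#I + #O + #U) = Fintype.card V := by
    rw [← Finset.card_union_of_disjoint hdisj, ← Finset.card_union_of_disjoint hdisjU, hunion,
      Finset.card_add_card_compl]
  have hcard' : (#K : ℤ) + (#I + #O + #U) = Fintype.card V := by exact_mod_cast hcard
  have hKK := h.le_sum_slack_self
  have hrow0 : ∀ w ∈ Kᶜ, 0 ≤ ∑ x ∈ K, slack D w x := fun w hw =>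
    Finset.sum_nonneg fun x _ => h.slack_nonneg (Finset.mem_compl.1 hw) x
  have hrow1 : ∀ w ∈ U, 1 ≤ ∑ x ∈ K, slack D w x := by
    intro w hw
    obtain ⟨hwK, x, hx, hna⟩ := Finset.mem_filter.1 hw
    rw [Finset.mem_compl] at hwK
    have := card_le_sum_slack_right (D := D) (w := w) (A := {x}) (X := K) (by simpa using hx)
      (fun x _ => h.asymm w hwK x) (fun y hy => by
        rw [Finset.mem_singleton.1 hy]
        exact ⟨fun e => hwK (e ▸ hx), hna⟩)
    simpa using this
  have hUsub : U ⊆ Kᶜ := Finset.filter_subset _ _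
  have hKW : (#U : ℤ) ≤ ∑ w ∈ Kᶜ, ∑ x ∈ K, slack D w x := by
    calc (#U : ℤ) = ∑ w ∈ U, 1 := by simp
      _ ≤ ∑ w ∈ U, ∑ x ∈ K, slack D w x := Finset.sum_le_sum hrow1
      _ ≤ _ := Finset.sum_le_sum_of_subset_of_nonneg hUsub fun w hw _ => hrow0 w hw
  have hasymm : ∀ u ∈ Kᶜ, ∀ v ∈ Kᶜ, D.Adj u v → ¬ D.Adj v u := fun u hu v _ =>
    h.asymm u (Finset.mem_compl.1 hu) v
  have hEI : ∀ e ∈ I.offDiag ∪ O.offDiag,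
      e.1 ∈ Kᶜ ∧ e.2 ∈ Kᶜ ∧ e.1 ≠ e.2 ∧ ¬ D.Adj e.1 e.2 ∧ ¬ D.Adj e.2 e.1 := by
    intro e he
    rcases Finset.mem_union.1 he with he | he
    · obtain ⟨h1, h2, h3⟩ := Finset.mem_offDiag.1 he
      rw [Finset.mem_filter] at h1 h2
      exact ⟨h1.1, h2.1, h3, h.not_adj_of_full_in (Finset.mem_compl.1 h2.1)
        (Finset.mem_compl.1 h1.1) hx₀ (h1.2 x₀ hx₀) h2.2⟩
    · obtain ⟨h1, h2, h3⟩ := Finset.mem_offDiag.1 he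
      rw [Finset.mem_filter] at h1 h2
      exact ⟨h1.1, h2.1, h3, h.not_adj_of_full_out (Finset.mem_compl.1 h2.1)
        (Finset.mem_compl.1 h1.1) hx₀ (h1.2 x₀ hx₀) h2.2⟩
  have hEcard : (#(I.offDiag ∪ O.offDiag) : ℤ) = #I * (#I - 1) + #O * (#O - 1) := by
    rw [Finset.card_union_of_disjoint, Finset.offDiag_card, Finset.offDiag_card]
    · rw [Nat.cast_add, Nat.cast_sub (Nat.le_mul_self _), Nat.cast_sub (Nat.le_mul_self _)]
      push_cast
      ring
    · rw [Finset.disjoint_left]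
      intro e he he'
      exact Finset.disjoint_left.1 hdisj (Finset.mem_offDiag.1 he).1 (Finset.mem_offDiag.1 he').1
  have hWW := card_le_sum_slack hasymm hEI
  rw [hEcard] at hWW
  have hquad : ∀ a : ℤ, 2 * (a - 1) ≤ a * (a - 1) := by
    intro a
    rcases le_or_gt a 1 with ha | ha <;> nlinarith
  have hKpos : 0 < #K := Finset.card_pos.2 h.nonempty
  -- For `|K| = 2, 3` the product `(|K| - 1) (|K| - 4)` is `-2`. The missing 2 comes from `|I|` or
  -- `|O|` outside `{1, 2}`, from a second non-neighbour in `K` of some `w ∈ U`, or else from a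
  -- non-adjacent pair between `U` and `I ∪ O`.
  by_cases hK : 2 ≤ #K ∧ #K ≤ 3
  · by_contra! hlt
    have hI2 : #I = 1 ∨ #I = 2 := by
      by_contra hc
      have : 2 * ((#I : ℤ) - 1) + 2 ≤ #I * (#I - 1) := by
        have : #I = 0 ∨ 3 ≤ #I := by omega
        rcases this with h0 | h0
        · simp [h0]
        · have : (3 : ℤ) ≤ #I := by exact_mod_cast h0
          nlinarith
      have hO' := hquad #O
      have : #K = 2 ∨ #K = 3 := by omega
      rcases this with h0 | h0 <;> rw [h0] at hKK hcard' <;> push_cast at hKK hcard' <;> linarith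
    have hO2 : #O = 1 ∨ #O = 2 := by
      by_contra hc
      have : 2 * ((#O : ℤ) - 1) + 2 ≤ #O * (#O - 1) := by
        have : #O = 0 ∨ 3 ≤ #O := by omega
        rcases this with h0 | h0
        · simp [h0]
        · have : (3 : ℤ) ≤ #O := by exact_mod_cast h0
          nlinarith
      have hI' := hquad #I
      have : #K = 2 ∨ #K = 3 := by omega
      rcases this with h0 | h0 <;> rw [h0] at hKK hcard' <;> push_cast at hKK hcard' <;> linarith
    have hI' := hquad #I
    have hO' := hquad #O
    -- At most `3 + 2 + 2` of the at least 10 vertices lie in `K ∪ I ∪ O`.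
    obtain ⟨w, hwU⟩ : U.Nonempty := Finset.card_pos.1 (by omega)
    obtain ⟨zi, hzi⟩ : I.Nonempty := Finset.card_pos.1 (by omega)
    obtain ⟨zo, hzo⟩ : O.Nonempty := Finset.card_pos.1 (by omega)
    have hm : ∑ x ∈ K, slack D w x ≤ 1 := by
      by_contra! hm
      have : (#U : ℤ) + 1 ≤ ∑ w ∈ Kᶜ, ∑ x ∈ K, slack D w x := by
        calc (#U : ℤ) + 1 = ∑ v ∈ U, (1 + if v = w then 1 else 0) := by
              rw [Finset.sum_add_distrib, Finset.sum_ite_eq' U w, if_pos hwU]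
              simp
          _ ≤ ∑ v ∈ U, ∑ x ∈ K, slack D v x := by
              refine Finset.sum_le_sum fun v hv => ?_
              split_ifs with hvw
              · rw [hvw]; linarith
              · simpa using hrow1 v hv
          _ ≤ _ := Finset.sum_le_sum_of_subset_of_nonneg hUsub fun w hw _ => hrow0 w hw
      have : #K = 2 ∨ #K = 3 := by omega
      rcases this with h0 | h0 <;> rw [h0] at hKK hcard' <;> push_cast at hKK hcard' <;> linarith
    have hwK : w ∉ K := Finset.mem_compl.1 (hUsub hwU)
    obtain ⟨z, hz, hwz⟩ : ∃ z ∈ I ∪ O, ¬ D.Adj w z ∧ ¬ D.Adj z w := by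
      rw [Finset.mem_filter, Finset.mem_compl] at hzi hzo
      rcases h.exists_twin hK.1 hwK hm hzi.1 hzi.2 hzo.1 hzo.2 with h' | h'
      · exact ⟨zi, Finset.mem_union_left _ (by simp [hI, hzi.1]; exact hzi.2), h'⟩
      · exact ⟨zo, Finset.mem_union_right _ (by simp [hO, hzo.1]; exact hzo.2), h'⟩
    have hwnot : w ∉ I ∪ O := fun h' => Finset.disjoint_left.1 hdisjU h' hwU
    have hzW : z ∈ Kᶜ := hunion ▸ Finset.mem_union_left _ hz
    have hzw : z ≠ w := fun e => hwnot (e ▸ hz)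
    have hE2 := card_le_sum_slack (E := (I.offDiag ∪ O.offDiag) ∪ {(w, z), (z, w)}) hasymm (by
      intro e he
      rcases Finset.mem_union.1 he with he | he
      · exact hEI e he
      · rw [Finset.mem_insert, Finset.mem_singleton] at he
        rcases he with rfl | rfl
        · exact ⟨hUsub hwU, hzW, hzw.symm, hwz.1, hwz.2⟩
        · exact ⟨hzW, hUsub hwU, hzw, hwz.2, hwz.1⟩)
    rw [Finset.card_union_of_disjoint, Finset.card_pair (by simp [hzw]), Nat.cast_add, hEcard] at hE2
    · have : #K = 2 ∨ #K = 3 := by omega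
      rcases this with h0 | h0 <;> rw [h0] at hKK hcard' <;> push_cast at hKK hcard' hE2 <;>
        linarith
    · rw [Finset.disjoint_right]
      intro e he he'
      have hboth : e.1 ∈ I ∪ O ∧ e.2 ∈ I ∪ O := by
        rcases Finset.mem_union.1 he' with he' | he' <;> rw [Finset.mem_offDiag] at he'
        · exact ⟨Finset.mem_union_left _ he'.1, Finset.mem_union_left _ he'.2.1⟩
        · exact ⟨Finset.mem_union_right _ he'.1, Finset.mem_union_right _ he'.2.1⟩
      rw [Finset.mem_insert, Finset.mem_singleton] at he
      rcases he with rfl | rfl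
      · exact hwnot hboth.1
      · exact hwnot hboth.2
  · have hI' := hquad #I
    have hO' := hquad #O
    have : 0 ≤ ((#K : ℤ) - 1) * (#K - 4) := by
      have : #K = 1 ∨ 4 ≤ #K := by omega
      rcases this with h0 | h0
      · simp [h0]
      · have : (4 : ℤ) ≤ #K := by exact_mod_cast h0
        nlinarith
    linarith

end Core

/-! ### Loops, 2-cycles and shortest cycles are cores. -/

section Cycles

variable {V : Type*} {D : Digraph V}

theorem isWalk_two {a b c : V} (h1 : D.Adj a b) (h2 : D.Adj b c) : IsWalk D ![a, b, c] := by
  intro i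
  fin_cases i <;> assumption

theorem isWalk_three {a b c d : V} (h1 : D.Adj a b) (h2 : D.Adj b c) (h3 : D.Adj c d) :
    IsWalk D ![a, b, c, d] := by
  intro i
  fin_cases i <;> assumption

theorem isWalk_four {a b c d e : V} (h1 : D.Adj a b) (h2 : D.Adj b c) (h3 : D.Adj c d)
    (h4 : D.Adj d e) : IsWalk D ![a, b, c, d, e] := by
  intro i
  fin_cases i <;> assumption

theorem isWalk_five {a b c d e f : V} (h1 : D.Adj a b) (h2 : D.Adj b c) (h3 : D.Adj c d)
    (h4 : D.Adj d e) (h5 : D.Adj e f) : IsWalk D ![a, b, c, d, e, f] := by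
  intro i
  fin_cases i <;> assumption

theorem IsFree.not_adj_in {k : ℕ} (h : IsFree D k) (hk : 2 ≤ k) {K : Finset V}
    (hK : ∀ x ∈ K, ∃ y ∈ K, D.Adj x y) : ∀ w ∉ K, ∀ v ∉ K, D.Adj w v →
      ∀ x ∈ K, ∀ y ∈ K, D.Adj x y → D.Adj w x → ¬ D.Adj v y := by
  intro w _ v hv hwv x hx y hy hxy hwx hvy
  have := h.eq_of_last_mem (K := (K : Set V)) hK hk (isWalk_two hwv hvy) (isWalk_two hwx hxy)
    rfl rfl hy
  have h1 : v = x := congrFun this 1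
  exact hv (h1 ▸ hx)

theorem IsFree.not_adj_out {k : ℕ} (h : IsFree D k) (hk : 2 ≤ k) {K : Finset V}
    (hK : ∀ y ∈ K, ∃ x ∈ K, D.Adj x y) : ∀ w ∉ K, ∀ v ∉ K, D.Adj w v →
      ∀ x ∈ K, ∀ y ∈ K, D.Adj x y → D.Adj x w → ¬ D.Adj y v := by
  intro w hw v _ hwv x hx y hy hxy hxw hyv
  have := h.eq_of_zero_mem (K := (K : Set V)) hK hk (isWalk_two hxw hwv) (isWalk_two hxy hyv)
    rfl rfl hx
  have h1 : w = y := congrFun this 1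
  exact hw (h1 ▸ hy)

/-- A vertex joined to all of `K` in mixed directions would lie on some `x → w → y` with `x, y ∈ K`.
-/
theorem full_of_not_through {K : Finset V} {w : V}
    (h : ∀ x ∈ K, ∀ y ∈ K, D.Adj x w → ¬ D.Adj w y) (hw : ∀ x ∈ K, D.Adj w x ∨ D.Adj x w) :
    (∀ x ∈ K, D.Adj w x) ∨ (∀ x ∈ K, D.Adj x w) := by
  by_contra! hcon
  obtain ⟨⟨x, hx, hx'⟩, y, hy, hy'⟩ := hcon
  exact h x hx y hy ((hw x hx).resolve_left hx') ((hw y hy).resolve_right hy')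

open Classical in
/-- The vertices on loops and on `2`-cycles. -/
noncomputable def loopsAndDigons [Fintype V] (D : Digraph V) : Finset V :=
  {x | ∃ y, D.Adj x y ∧ D.Adj y x}

/-- Every core vertex lies on a closed walk of length 2, possibly a loop run twice. A walk between
two core vertices can make this excursion at its start or at its end; freeness identifies the two
resulting walks. -/
theorem isCycleCore_loopsAndDigons [Fintype V] {k : ℕ} (h : IsFree D k) (hk : 5 ≤ k)
    (hne : (loopsAndDigons D).Nonempty) : IsCycleCore D (loopsAndDigons D) := by
  classical
  have mem : ∀ {x}, x ∈ loopsAndDigons D ↔ ∃ y, D.Adj x y ∧ D.Adj y x := by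
    simp [loopsAndDigons]
  have partner : ∀ x ∈ loopsAndDigons D, ∃ y ∈ loopsAndDigons D, D.Adj x y ∧ D.Adj y x := by
    intro x hx
    obtain ⟨y, hxy, hyx⟩ := mem.1 hx
    exact ⟨y, mem.2 ⟨x, hyx, hxy⟩, hxy, hyx⟩
  have hs : ∀ x ∈ loopsAndDigons D, ∃ y ∈ loopsAndDigons D, D.Adj x y := fun x hx =>
    (partner x hx).imp fun y hy => ⟨hy.1, hy.2.1⟩
  have hp : ∀ y ∈ loopsAndDigons D, ∃ x ∈ loopsAndDigons D, D.Adj x y := fun x hx =>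
    (partner x hx).imp fun y hy => ⟨hy.1, hy.2.2⟩
  refine ⟨hne, hs, hp, ?_, ?_, h.not_adj_in (by omega) hs, h.not_adj_out (by omega) hp, ?_⟩
  · have key : ∀ x x' y, D.Adj x x' → D.Adj x' x → y ∈ loopsAndDigons D → D.Adj x y → x' = y := by
      intro x x' y h1 h2 hy hxy
      obtain ⟨y', hy', h3, h4⟩ := partner y hy
      have := h.eq_of_last_mem (K := (loopsAndDigons D : Set V)) hs (m := 3) (by omega)
        (isWalk_three h1 h2 hxy) (isWalk_three hxy h3 h4) rfl rfl hy
      exact congrFun this 1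
    intro x hx y hy z hz hxy hxz
    obtain ⟨x', hx', h1, h2⟩ := partner x hx
    rw [← key x x' y h1 h2 hy hxy, key x x' z h1 h2 hz hxz]
  · intro w hw v hwv hvw
    exact hw (mem.2 ⟨v, hwv, hvw⟩)
  · intro w hw
    refine full_of_not_through fun x hx y hy hxw hwy => hw ?_
    obtain ⟨x', hx', h1, h2⟩ := partner x hx
    obtain ⟨y', hy', h3, h4⟩ := partner y hy
    have := h.eq_of_last_mem (K := (loopsAndDigons D : Set V)) hs (m := 4) (by omega)
      (isWalk_four h1 h2 hxw hwy) (isWalk_four hxw hwy h3 h4) rfl rfl hy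
    have h1 : x' = w := congrFun this 1
    exact h1 ▸ hx'

/-- `D` has a closed walk of length `g`. -/
def HasClosedWalk (D : Digraph V) (g : ℕ) : Prop :=
  0 < g ∧ ∃ c : ℕ → V, c 0 = c g ∧ ∀ i < g, D.Adj (c i) (c (i + 1))

theorem exists_hasClosedWalk [Finite V] (h : ¬ WellFounded D.Adj) : ∃ g, HasClosedWalk D g := by
  rw [wellFounded_iff_isEmpty_descending_chain, not_isEmpty_iff] at h
  obtain ⟨f, hf⟩ := h
  obtain ⟨i, j, hne, hij⟩ := Finite.exists_ne_map_eq_of_infinite f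
  wlog hlt : i < j generalizing i j
  · exact this j i hne.symm hij.symm (by omega)
  -- The chain `f` runs against the arcs, so it is read backwards from `j`.
  refine ⟨j - i, by omega, fun a => f (j - a), ?_, fun a ha => ?_⟩
  · simp only [Nat.sub_zero]
    rw [← hij]
    congr 1
    omega
  · have := hf (j - (a + 1))
    rwa [show j - (a + 1) + 1 = j - a by omega] at this

/-- The vertices of a closed walk, as a periodic sequence. -/
theorem exists_periodic {g : ℕ} (h : HasClosedWalk D g) :
    ∃ p : ℕ → V, (∀ i, D.Adj (p i) (p (i + 1))) ∧ ∀ i, p (i + g) = p i := by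
  obtain ⟨hg, c, hc0, hc⟩ := h
  refine ⟨fun i => c (i % g), fun i => ?_, fun i => by simp⟩
  have hi := Nat.mod_lt i hg
  have := hc _ hi
  by_cases hlast : i % g + 1 = g
  · have h0 : (i + 1) % g = 0 := by
      rw [Nat.add_mod]
      rcases Nat.lt_or_ge 1 g with h1 | h1
      · rw [Nat.mod_eq_of_lt h1, hlast, Nat.mod_self]
      · rw [show g = 1 by omega, Nat.mod_one]
    simp only [h0]
    rw [hlast, ← hc0] at this
    exact this
  · have h0 : (i + 1) % g = i % g + 1 := by
      rw [Nat.add_mod, Nat.mod_eq_of_lt (show 1 < g by omega), Nat.mod_eq_of_lt (by omega)]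
    simp only [h0]
    exact this

section Shortest

variable {g : ℕ} {p : ℕ → V}

theorem eq_mod_of_periodic (hper : ∀ i, p (i + g) = p i) (i : ℕ) : p (i % g) = p i :=
  Function.Periodic.map_mod_nat (f := p) hper i

theorem adj_of_shortest (hmin : ∀ m, HasClosedWalk D m → g ≤ m)
    (hp : ∀ i, D.Adj (p i) (p (i + 1))) (hper : ∀ i, p (i + g) = p i) {i j : ℕ} (hi : i < g)
    (hj : j < g) (hij : D.Adj (p i) (p j)) : p j = p (i + 1) := by
  -- `d` counts the steps along the cycle from `p j` to `p i`. The arc back to `p j` closes a walk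
  -- of length `d + 1 ≤ g`, so minimality leaves only `d + 1 = g`.
  obtain ⟨d, hd, hdi⟩ : ∃ d < g, p (j + d) = p i ∧ (d + 1 = g → p j = p (i + 1)) := by
    rcases le_or_gt j i with h | h
    · refine ⟨i - j, by omega, by congr 1; omega, fun hd => ?_⟩
      rw [show j = 0 by omega, show i + 1 = 0 + g by omega, hper]
    · refine ⟨i + g - j, by omega, ?_, fun hd => by congr 1; omega⟩
      rw [← hper i]
      congr 1
      omega
  have := hmin (d + 1) ⟨by omega, fun a => if a ≤ d then p (j + a) else p j, by simp, by
    intro a ha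
    rcases Nat.lt_or_ge a d with h | h
    · simp only [if_pos h.le, if_pos (Nat.succ_le_of_lt h)]
      exact hp (j + a)
    · have : a = d := by omega
      subst this
      simpa [hdi.1] using hij⟩
  exact hdi.2 (by omega)

theorem isCycleCore_of_shortest [DecidableEq V] {k : ℕ} (h : IsFree D k) (hk : 5 ≤ k)
    (hg : 3 ≤ g) (hmin : ∀ m, HasClosedWalk D m → g ≤ m)
    (hp : ∀ i, D.Adj (p i) (p (i + 1))) (hper : ∀ i, p (i + g) = p i) :
    IsCycleCore D ((range g).image p) := by
  have hmem : ∀ i, p i ∈ (range g).image p := fun i =>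
    Finset.mem_image.2 ⟨i % g, Finset.mem_range.2 (Nat.mod_lt _ (by omega)),
      eq_mod_of_periodic hper i⟩
  have hrep : ∀ {x}, x ∈ (range g).image p → ∃ i < g, p i = x := by
    intro x hx
    obtain ⟨i, hi, rfl⟩ := Finset.mem_image.1 hx
    exact ⟨i, Finset.mem_range.1 hi, rfl⟩
  have hs : ∀ x ∈ (range g).image p, ∃ y ∈ (range g).image p, D.Adj x y := by
    intro x hx
    obtain ⟨i, -, rfl⟩ := hrep hx
    exact ⟨_, hmem _, hp i⟩
  have hpr : ∀ x ∈ (range g).image p, ∃ y ∈ (range g).image p, D.Adj y x := by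
    intro x hx
    obtain ⟨i, -, rfl⟩ := hrep hx
    refine ⟨_, hmem (i + (g - 1)), ?_⟩
    have := hp (i + (g - 1))
    rwa [show i + (g - 1) + 1 = i + g by omega, hper] at this
  refine ⟨⟨_, hmem 0⟩, hs, hpr, ?_, ?_, h.not_adj_in (by omega) hs, h.not_adj_out (by omega) hpr,
    ?_⟩
  · intro x hx y hy z hz hxy hxz
    obtain ⟨i, hi, rfl⟩ := hrep hx
    obtain ⟨j, hj, rfl⟩ := hrep hy
    obtain ⟨l, hl, rfl⟩ := hrep hz
    rw [adj_of_shortest hmin hp hper hi hj hxy, adj_of_shortest hmin hp hper hi hl hxz]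
  · intro w _ v hwv hvw
    have := hmin 2 ⟨by omega, fun a => if a = 1 then v else w, by simp, by
      intro i hi
      interval_cases i <;> simpa⟩
    omega
  · intro w hw hadj
    -- If `g > 3`, a change of direction along the cycle would create a triangle through `w`. If `g
    -- = 3`, a walk `x → w → y` can go round the triangle before or after it; these walks have
    -- length 5, which is where `5 ≤ k` enters.
    rcases Nat.lt_or_ge 3 g with h3 | h3
    · have hstep : ∀ i, D.Adj w (p i) → D.Adj w (p (i + 1)) := by
        intro i hi
        refine (hadj _ (hmem (i + 1))).resolve_right fun hback => ?_
        have := hmin 3 ⟨by omega,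
          fun a => if a = 1 then p i else if a = 2 then p (i + 1) else w, by simp, by
            intro a ha
            interval_cases a
            · simpa using hi
            · simpa using hp i
            · simpa using hback⟩
        omega
      by_cases hex : ∃ i, D.Adj w (p i)
      · left
        obtain ⟨i, hi⟩ := hex
        have hall : ∀ j, D.Adj w (p (i + j)) := by
          intro j
          induction j with
          | zero => exact hi
          | succ j ih => exact hstep _ ih
        intro x hx
        obtain ⟨j, hj, rfl⟩ := hrep hx
        have hmul : ∀ r, p (j + r * g) = p j := by
          intro r
          induction r with
          | zero => simp
          | succ r ih => rw [Nat.succ_mul, ← add_assoc, hper, ih]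
        -- Arcs from `w` propagate only forwards, so `p j` is reached after enough full turns.
        have := hall (j + i * g - i)
        have hle : i ≤ i * g := Nat.le_mul_of_pos_right _ (by omega)
        rwa [show i + (j + i * g - i) = j + i * g by omega, hmul] at this
      · right
        intro x hx
        obtain ⟨j, hj, rfl⟩ := hrep hx
        exact (hadj _ hx).resolve_left fun hw' => hex ⟨j, hw'⟩
    · have hg3 : g = 3 := by omega
      subst hg3
      refine full_of_not_through (fun x hx y hy hxw hwy => hw ?_) hadj
      obtain ⟨i, hi, rfl⟩ := hrep hx
      obtain ⟨j, hj, rfl⟩ := hrep hy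
      have h1 := hp (i + 2)
      have h2 := hp (j + 2)
      rw [show i + 2 + 1 = i + 3 by omega, hper] at h1
      rw [show j + 2 + 1 = j + 3 by omega, hper] at h2
      have := h.eq_of_last_mem (K := ((range 3).image p : Finset V)) hs (m := 5) (by omega)
        (isWalk_five (hp i) (hp (i + 1)) h1 hxw hwy)
        (isWalk_five hxw hwy (hp j) (hp (j + 1)) h2) rfl rfl hy
      have h1 : p (i + 1) = w := congrFun this 1
      exact h1 ▸ hmem _

end Shortest

theorem le_sum_slack_of_not_wellFounded [Fintype V] {k : ℕ} (h : IsFree D k) (hk : 5 ≤ k)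
    (hV : 10 ≤ Fintype.card V) (hwf : ¬ WellFounded D.Adj) :
    2 * ((Fintype.card V : ℤ) - 4) ≤ ∑ u, ∑ v, slack D u v := by
  classical
  by_cases hne : (loopsAndDigons D).Nonempty
  · exact (isCycleCore_loopsAndDigons h hk hne).le_sum_slack hV
  · have hex := exists_hasClosedWalk hwf
    have hcw := Nat.find_spec hex
    have hmin : ∀ m, HasClosedWalk D m → Nat.find hex ≤ m := fun m hm => Nat.find_min' hex hm
    obtain ⟨p, hp, hper⟩ := exists_periodic hcw
    have hno : ∀ x y, D.Adj x y → ¬ D.Adj y x := fun x y hxy hyx =>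
      hne ⟨x, by simpa [loopsAndDigons] using ⟨y, hxy, hyx⟩⟩
    have hg : 3 ≤ Nat.find hex := by
      by_contra! hlt
      have hpos := hcw.1
      have h0 := hper 0
      have : Nat.find hex = 1 ∨ Nat.find hex = 2 := by omega
      rcases this with h1 | h1 <;> rw [h1] at h0
      · have := hp 0
        rw [h0] at this
        exact hno _ _ this this
      · have h2 := hp 1
        rw [show 1 + 1 = 0 + 2 by omega, h0] at h2
        exact hno _ _ (hp 0) h2
    exact (isCycleCore_of_shortest h hk hg hmin hp hper).le_sum_slack hV

end Cycles

/-! ### Acyclic digraphs with a walk of length at least `k`. -/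

section Acyclic

variable {V : Type*} {D : Digraph V}

/-- `h v` is the length of a longest walk ending at `v`, which exists if `D` is acyclic. -/
structure IsLevel (D : Digraph V) (h : V → ℕ) : Prop where
  lt : ∀ {u v}, D.Adj u v → h u < h v
  exists_pred : ∀ v, h v ≠ 0 → ∃ u, D.Adj u v ∧ h u + 1 = h v

theorem exists_isLevel [Fintype V] (hwf : WellFounded D.Adj) : ∃ h, IsLevel D h := by
  classical
  let F : ∀ v, (∀ u, D.Adj u v → ℕ) → ℕ := fun v ih =>
    -- Non-predecessors contribute 0, which does not affect the supremum, so sources get level 0.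
    univ.sup fun u => if hu : D.Adj u v then ih u hu + 1 else 0
  have hfix : ∀ v, hwf.fix F v = univ.sup fun u => if D.Adj u v then hwf.fix F u + 1 else 0 := by
    intro v
    rw [hwf.fix_eq]
    simp only [F, dite_eq_ite]
  refine ⟨hwf.fix F, fun {u v} huv => ?_, fun v hv => ?_⟩
  · rw [hfix v]
    have := Finset.le_sup (f := fun u => if D.Adj u v then hwf.fix F u + 1 else 0)
      (Finset.mem_univ u)
    simp only [if_pos huv] at this
    omega
  · obtain ⟨u, -, hu⟩ := Finset.exists_mem_eq_sup univ ⟨v, Finset.mem_univ v⟩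
      fun u => if D.Adj u v then hwf.fix F u + 1 else 0
    rw [← hfix v] at hu
    by_cases huv : D.Adj u v
    · exact ⟨u, huv, by rw [hu, if_pos huv]⟩
    · rw [if_neg huv] at hu
      exact absurd hu hv

namespace IsLevel

variable {h : V → ℕ}

theorem asymm (hl : IsLevel D h) {u v : V} (huv : D.Adj u v) : ¬ D.Adj v u := fun hvu =>
  lt_asymm (hl.lt huv) (hl.lt hvu)

theorem slack_nonneg (hl : IsLevel D h) (u v : V) : 0 ≤ slack D u v :=
  TuranWalk.slack_nonneg hl.asymm

theorem not_adj_of_eq (hl : IsLevel D h) {u v : V} (huv : h u = h v) :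
    ¬ D.Adj u v ∧ ¬ D.Adj v u :=
  ⟨fun h' => (hl.lt h').ne huv, fun h' => (hl.lt h').ne huv.symm⟩

theorem exists_path (hl : IsLevel D h) {L : ℕ} : ∀ v, h v = L →
    ∃ p : ℕ → V, (∀ i ≤ L, h (p i) = i) ∧ ∀ i < L, D.Adj (p i) (p (i + 1)) := by
  suffices H : ∀ v, h v = L → ∃ p : ℕ → V, p L = v ∧ (∀ i ≤ L, h (p i) = i) ∧
      ∀ i < L, D.Adj (p i) (p (i + 1)) from fun v hv => (H v hv).imp fun p hp => hp.2
  induction L with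
  | zero =>
    intro v hv
    exact ⟨fun _ => v, rfl, fun i hi => by rw [hv]; omega, fun i hi => by omega⟩
  | succ L ih =>
    intro v hv
    obtain ⟨u, huv, hu⟩ := hl.exists_pred v (by omega)
    obtain ⟨p, hpL, hph, hpa⟩ := ih u (by omega)
    refine ⟨Function.update p (L + 1) v, by simp, fun i hi => ?_, fun i hi => ?_⟩
    · rcases Nat.lt_or_ge L i with h' | h'
      · rw [show i = L + 1 by omega, Function.update_self, hv]
      · rw [Function.update_of_ne (by omega), hph i h']
    · rcases Nat.lt_or_ge i L with h' | h'
      · rw [Function.update_of_ne (by omega), Function.update_of_ne (by omega)]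
        exact hpa i h'
      · rw [show i = L by omega, Function.update_of_ne (by omega), Function.update_self, hpL]
        exact huv

section Path

variable {k L : ℕ} {p : ℕ → V}

/-- Two chords of the form `p a → p (a + 2)` of a longest path are far apart. -/
theorem chord_far (hf : IsFree D k) (hkL : k < L) (hph : ∀ i ≤ L, h (p i) = i)
    (hpa : ∀ i < L, D.Adj (p i) (p (i + 1))) {a b : ℕ} (hab : a < b) (hb : b + 2 ≤ L)
    (ha : D.Adj (p a) (p (a + 2))) (hb' : D.Adj (p b) (p (b + 2))) : a + k ≤ b := by
  by_contra! hlt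
  -- Both chords fit into a window of length `k + 1` of the path. Skipping `p (a + 1)` or `p (b +
  -- 1)` in it gives two walks of length `k` with the same ends. The witness is truncated at 0.
  obtain ⟨i, hia, hib, hiL⟩ : ∃ i, i ≤ a ∧ b + 2 ≤ i + k + 1 ∧ i + k + 1 ≤ L :=
    ⟨b + 1 - k, by omega, by omega, by omega⟩
  have hwalk : ∀ c, i ≤ c → c + 2 ≤ i + k + 1 → D.Adj (p c) (p (c + 2)) → ∀ j < k,
      D.Adj (if i + j ≤ c then p (i + j) else p (i + j + 1))
        (if i + (j + 1) ≤ c then p (i + (j + 1)) else p (i + (j + 1) + 1)) := by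
    intro c _ _ hadj j hj
    rcases lt_trichotomy (i + j) c with h' | h' | h'
    · rw [if_pos (by omega), if_pos (by omega)]
      exact hpa _ (by omega)
    · rw [if_pos (by omega), if_neg (by omega), h', ← add_assoc, h']
      exact hadj
    · rw [if_neg (by omega), if_neg (by omega)]
      exact hpa _ (by omega)
  have := hf.eq_of_seq (hwalk a (by omega) (by omega) ha) (hwalk b (by omega) (by omega) hb')
    (by rw [if_pos (by omega), if_pos (by omega)])
    (by rw [if_neg (by omega), if_neg (by omega)]) (i := a + 1 - i) (by omega)
  rw [if_neg (by omega), if_pos (by omega)] at this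
  have := congrArg h this
  rw [hph _ (by omega), hph _ (by omega)] at this
  omega

variable [DecidableEq V]

theorem card_path (hph : ∀ i ≤ L, h (p i) = i) : #((range (L + 1)).image p) = L + 1 := by
  rw [Finset.card_image_of_injOn, Finset.card_range]
  intro i hi j hj hij
  rw [Finset.mem_coe, Finset.mem_range] at hi hj
  rw [← hph i (by omega), ← hph j (by omega), hij]

/-- The path meets every level, in particular that of `x`, and vertices of equal level are
non-adjacent. -/
theorem row_pos (hl : IsLevel D h) (hph : ∀ i ≤ L, h (p i) = i) (hL : ∀ v, h v ≤ L) {x : V}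
    (hx : x ∉ (range (L + 1)).image p) :
    1 ≤ ∑ y ∈ (range (L + 1)).image p, slack D x y := by
  have hmem : p (h x) ∈ (range (L + 1)).image p :=
    Finset.mem_image_of_mem p (Finset.mem_range.2 (Nat.lt_succ_of_le (hL x)))
  have := card_le_sum_slack_right (D := D) (w := x) (A := {p (h x)})
    (Finset.singleton_subset_iff.2 hmem) (fun _ _ => hl.asymm) (fun y hy => by
      rw [Finset.mem_singleton.1 hy]
      exact ⟨fun e => hx (e ▸ hmem), hl.not_adj_of_eq (hph _ (hL x)).symm⟩)
  simpa using this

/-- Of the `L - 1` possible chords `p a → p (a + 2)` at most two are present, since three would need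
`2 k ≤ L - 2 ≤ k + 2`. The missing ones cost `2 (L - 3)` and the `k + 4 - L` vertices off the path
cost 2 each, in all `2 (k + 1) ≥ 12`. -/
theorem le_sum_slack_of_lt [Fintype V] (hl : IsLevel D h) (hf : IsFree D k) (hk : 5 ≤ k)
    (hV : Fintype.card V = k + 5) (hkL : k < L) (hph : ∀ i ≤ L, h (p i) = i)
    (hpa : ∀ i < L, D.Adj (p i) (p (i + 1))) (hL : ∀ v, h v ≤ L) :
    12 ≤ ∑ u, ∑ v, slack D u v := by
  classical
  set P := (range (L + 1)).image p with hP
  have hPcard : #P = L + 1 := card_path hph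
  have hcompl : #P + #Pᶜ = k + 5 := by rw [Finset.card_add_card_compl, hV]
  have hpne : ∀ i j, i ≤ L → j ≤ L → i ≠ j → p i ≠ p j := fun i j hi hj hne he =>
    hne (by rw [← hph i hi, ← hph j hj, he])
  have hmemP : ∀ i ≤ L, p i ∈ P := fun i hi =>
    Finset.mem_image_of_mem p (Finset.mem_range.2 (Nat.lt_succ_of_le hi))
  rw [sum_slack_split D P]
  have hXX : 0 ≤ ∑ w ∈ Pᶜ, ∑ v ∈ Pᶜ, slack D w v :=
    Finset.sum_nonneg fun _ _ => Finset.sum_nonneg fun _ _ => hl.slack_nonneg _ _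
  have hXP : (#Pᶜ : ℤ) ≤ ∑ w ∈ Pᶜ, ∑ x ∈ P, slack D w x := by
    calc (#Pᶜ : ℤ) = ∑ w ∈ Pᶜ, 1 := by simp
      _ ≤ _ := Finset.sum_le_sum fun w hw => hl.row_pos hph hL (Finset.mem_compl.1 hw)
  set A := (range (L - 1)).filter fun a => D.Adj (p a) (p (a + 2)) with hA
  set M := (range (L - 1)).filter fun a => ¬ D.Adj (p a) (p (a + 2)) with hM
  have hAM : #A + #M = L - 1 := by
    rw [hA, hM, Finset.card_filter_add_card_filter_not, Finset.card_range]
  have hfar : ∀ a ∈ A, ∀ b ∈ A, a < b → a + k ≤ b := by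
    intro a ha b hb hab
    rw [Finset.mem_filter, Finset.mem_range] at ha hb
    exact chord_far hf hkL hph hpa hab (by omega) ha.2 hb.2
  have hA2 : #A ≤ 2 := by
    by_contra! hlt
    obtain ⟨a, b, c, ha, hb, hc, hab, hac, hbc⟩ := Finset.two_lt_card_iff.1 hlt
    have h1 := hfar a ha b hb
    have h2 := hfar b hb a ha
    have h3 := hfar a ha c hc
    have h4 := hfar c hc a ha
    have h5 := hfar b hb c hc
    have h6 := hfar c hc b hb
    rw [Finset.mem_filter, Finset.mem_range] at ha hb hc
    omega
  have hMlt : ∀ a ∈ M, a + 2 ≤ L ∧ ¬ D.Adj (p a) (p (a + 2)) := by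
    intro a ha
    rw [Finset.mem_filter, Finset.mem_range] at ha
    exact ⟨by omega, ha.2⟩
  have hnot : ∀ a ∈ M, ¬ D.Adj (p (a + 2)) (p a) := by
    intro a ha hadj
    have := hl.lt hadj
    rw [hph _ (hMlt a ha).1, hph a (by have := (hMlt a ha).1; omega)] at this
    omega
  have hE := card_le_sum_slack (D := D) (W := P)
    (E := M.image (fun a => (p a, p (a + 2))) ∪ M.image (fun a => (p (a + 2), p a)))
    (fun _ _ _ _ => hl.asymm) (by
      intro e he
      rcases Finset.mem_union.1 he with he | he <;>
        obtain ⟨a, ha, rfl⟩ := Finset.mem_image.1 he <;>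
        have h1 := hMlt a ha <;> have h2 := hnot a ha
      · exact ⟨hmemP _ (by omega), hmemP _ h1.1, hpne _ _ (by omega) h1.1 (by omega), h1.2, h2⟩
      · exact ⟨hmemP _ h1.1, hmemP _ (by omega), hpne _ _ h1.1 (by omega) (by omega), h2, h1.2⟩)
  have hEcard : #(M.image (fun a => (p a, p (a + 2))) ∪ M.image (fun a => (p (a + 2), p a)))
      = 2 * #M := by
    rw [Finset.card_union_of_disjoint, Finset.card_image_of_injOn, Finset.card_image_of_injOn,
      two_mul]
    · intro a ha b hb hab
      have h1 := hMlt a ha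
      have h2 := hMlt b hb
      have := congrArg (fun e => h e.2) hab
      simp only [hph a (by omega), hph b (by omega)] at this
      exact this
    · intro a ha b hb hab
      have h1 := hMlt a ha
      have h2 := hMlt b hb
      have := congrArg (fun e => h e.1) hab
      simp only [hph a (by omega), hph b (by omega)] at this
      exact this
    · rw [Finset.disjoint_left]
      intro e he he'
      obtain ⟨a, ha, rfl⟩ := Finset.mem_image.1 he
      obtain ⟨b, hb, hab⟩ := Finset.mem_image.1 he'
      have h1 := hMlt a ha
      have h2 := hMlt b hb
      have h3 := congrArg (fun e => h e.1) hab
      have h4 := congrArg (fun e => h e.2) hab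
      simp only [hph a (by omega), hph b (by omega), hph (a + 2) (by omega),
        hph (b + 2) (by omega)] at h3 h4
      omega
  rw [hEcard] at hE
  omega

/-- Besides `p (h x)`, the vertex `x` misses one of the path vertices just below and just above its
level; otherwise replacing `p (h x)` by `x` would give a second walk of length `k` with the same
ends. -/
theorem two_le_row (hl : IsLevel D h) (hf : IsFree D k) (hph : ∀ i ≤ k, h (p i) = i)
    (hpa : ∀ i < k, D.Adj (p i) (p (i + 1))) {x : V}
    (hx : x ∉ (range (k + 1)).image p) (h0 : 0 < h x) (hk : h x < k) :
    2 ≤ ∑ y ∈ (range (k + 1)).image p, slack D x y := by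
  have hmem : ∀ i ≤ k, p i ∈ (range (k + 1)).image p := fun i hi =>
    Finset.mem_image_of_mem p (Finset.mem_range.2 (Nat.lt_succ_of_le hi))
  obtain ⟨j, hj, hjne, hna⟩ : ∃ j ≤ k, j ≠ h x ∧ ¬ D.Adj x (p j) ∧ ¬ D.Adj (p j) x := by
    by_cases h1 : D.Adj (p (h x - 1)) x
    · refine ⟨h x + 1, by omega, by omega, fun h2 => hx ?_, fun h2 => ?_⟩
      · have := hf.eq_of_seq (f := p) (g := Function.update p (h x) x) hpa (fun i hi => by
            rcases lt_trichotomy (i + 1) (h x) with h' | h' | h'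
            · rw [Function.update_of_ne (by omega), Function.update_of_ne (by omega)]
              exact hpa i hi
            · rw [Function.update_of_ne (by omega), h', Function.update_self,
                show i = h x - 1 by omega]
              exact h1
            · rcases Nat.lt_or_ge (h x) i with h'' | h''
              · rw [Function.update_of_ne (by omega), Function.update_of_ne (by omega)]
                exact hpa i hi
              · rw [show i = h x by omega, Function.update_self, Function.update_of_ne (by omega)]
                exact h2)
          (by rw [Function.update_of_ne (by omega)]) (by rw [Function.update_of_ne (by omega)])
          (i := h x) hk.le
        rw [Function.update_self] at this
        exact this ▸ hmem _ hk.le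
      · have := hl.lt h2
        rw [hph _ (by omega)] at this
        omega
    · refine ⟨h x - 1, by omega, by omega, fun h2 => ?_, h1⟩
      have := hl.lt h2
      rw [hph _ (by omega)] at this
      omega
  have hne : p j ≠ p (h x) := fun e => hjne (by rw [← hph j hj, e, hph _ hk.le])
  have := card_le_sum_slack_right (D := D) (w := x) (X := (range (k + 1)).image p)
    (A := {p j, p (h x)})
    (by
      intro y hy
      rw [Finset.mem_insert, Finset.mem_singleton] at hy
      rcases hy with rfl | rfl
      · exact hmem j hj
      · exact hmem _ hk.le)
    (fun _ _ => hl.asymm) (fun y hy => by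
      rw [Finset.mem_insert, Finset.mem_singleton] at hy
      rcases hy with rfl | rfl
      · exact ⟨fun e => hx (e ▸ hmem j hj), hna⟩
      · exact ⟨fun e => hx (e ▸ hmem _ hk.le), hl.not_adj_of_eq (hph _ hk.le).symm⟩)
  rw [Finset.card_pair hne] at this
  exact_mod_cast this

/-- Four vertices lie off the path. If `a` of them have level 0 and `b` have level `k`, the slack is
at least `2 (8 - a - b) + a (a - 1) + b (b - 1) = 16 + a (a - 3) + b (b - 3) ≥ 12`. -/
theorem le_sum_slack_of_eq [Fintype V] (hl : IsLevel D h) (hf : IsFree D k) (hk : 5 ≤ k)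
    (hV : Fintype.card V = k + 5) (hph : ∀ i ≤ k, h (p i) = i)
    (hpa : ∀ i < k, D.Adj (p i) (p (i + 1))) (hL : ∀ v, h v ≤ k) :
    12 ≤ ∑ u, ∑ v, slack D u v := by
  set P := (range (k + 1)).image p with hP
  have hPcard : #P = k + 1 := card_path hph
  have hcompl : #P + #Pᶜ = k + 5 := by rw [Finset.card_add_card_compl, hV]
  have hX : #Pᶜ = 4 := by omega
  rw [sum_slack_split D P]
  have hPP : 0 ≤ ∑ w ∈ P, ∑ v ∈ P, slack D w v :=
    Finset.sum_nonneg fun _ _ => Finset.sum_nonneg fun _ _ => hl.slack_nonneg _ _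
  set A := Pᶜ.filter fun x => h x = 0 with hA
  set B := Pᶜ.filter fun x => h x = k with hB
  have hXP : 8 - (#A : ℤ) - #B ≤ ∑ w ∈ Pᶜ, ∑ x ∈ P, slack D w x := by
    calc 8 - (#A : ℤ) - #B
        = ∑ w ∈ Pᶜ, (2 - (if h w = 0 then 1 else 0) - if h w = k then 1 else 0) := by
          rw [Finset.sum_sub_distrib, Finset.sum_sub_distrib, Finset.sum_boole, Finset.sum_boole,
            Finset.sum_const, hX, hA, hB]
          norm_num
      _ ≤ _ := Finset.sum_le_sum fun w hw => by
          rw [Finset.mem_compl] at hw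
          have h1 : 1 ≤ ∑ x ∈ P, slack D w x := hl.row_pos hph hL hw
          have h2 : h w = 0 ∨ h w = k ∨ 2 ≤ ∑ x ∈ P, slack D w x := by
            by_cases h0 : h w = 0
            · exact Or.inl h0
            · by_cases h0' : h w = k
              · exact Or.inr (Or.inl h0')
              · exact Or.inr (Or.inr (hl.two_le_row hf hph hpa hw (Nat.pos_of_ne_zero h0)
                  (lt_of_le_of_ne (hL w) h0')))
          split_ifs <;> omega
  have hAB : Disjoint A B := by
    rw [Finset.disjoint_left]
    intro x hxA hxB
    have h1 := (Finset.mem_filter.1 hxA).2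
    have h2 := (Finset.mem_filter.1 hxB).2
    omega
  have hXX := card_le_sum_slack (D := D) (W := Pᶜ) (E := A.offDiag ∪ B.offDiag)
    (fun _ _ _ _ => hl.asymm) (by
      intro e he
      rcases Finset.mem_union.1 he with he | he <;>
      · obtain ⟨h1, h2, h3⟩ := Finset.mem_offDiag.1 he
        rw [Finset.mem_filter] at h1 h2
        exact ⟨h1.1, h2.1, h3, hl.not_adj_of_eq (h1.2.trans h2.2.symm)⟩)
  rw [Finset.card_union_of_disjoint, Finset.offDiag_card, Finset.offDiag_card, Nat.cast_add,
    Nat.cast_sub (Nat.le_mul_self _), Nat.cast_sub (Nat.le_mul_self _)] at hXX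
  · push_cast at hXX
    have hq : ∀ a : ℤ, -2 ≤ a * (a - 3) := fun a => by
      rcases le_or_gt a 1 with ha | ha <;> nlinarith
    have := hq #A
    have := hq #B
    linarith
  · rw [Finset.disjoint_left]
    intro e he he'
    exact Finset.disjoint_left.1 hAB (Finset.mem_offDiag.1 he).1 (Finset.mem_offDiag.1 he').1

end Path

theorem le_sum_slack [Fintype V] {k : ℕ} (hl : IsLevel D h) (hf : IsFree D k) (hk : 5 ≤ k)
    (hV : Fintype.card V = k + 5) {v : V} (hv : k ≤ h v) : 12 ≤ ∑ u, ∑ v, slack D u v := by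
  classical
  obtain ⟨t, -, ht⟩ := Finset.exists_max_image univ h ⟨v, Finset.mem_univ v⟩
  have hL : ∀ v, h v ≤ h t := fun v => ht v (Finset.mem_univ v)
  obtain ⟨p, hph, hpa⟩ := hl.exists_path t rfl
  rcases (hv.trans (hL v)).lt_or_eq with hlt | heq
  · exact hl.le_sum_slack_of_lt hf hk hV hlt hph hpa hL
  · rw [← heq] at hph hpa hL
    exact hl.le_sum_slack_of_eq hf hk hV hph hpa hL

end IsLevel

end Acyclic

/-! ### Digraphs with `k` layers, and the equality case. -/

section Layers

variable {V : Type*} {D : Digraph V} {k : ℕ}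

theorem same_le_slack [DecidableEq V] {l : V → Fin k} (hl : ∀ u v, D.Adj u v → l u < l v)
    (u v : V) : (if l v = l u ∧ u ≠ v then 1 else 0 : ℤ) ≤ slack D u v := by
  split_ifs with h
  · rw [slack_eq_one h.2 (fun h' => (hl _ _ h').ne h.1.symm) (fun h' => (hl _ _ h').ne h.1)]
  · exact slack_nonneg fun h1 h2 => lt_asymm (hl _ _ h1) (hl _ _ h2)

variable [Fintype V]

/-- `l` exhibits `D` as a transitive tournament on `k` vertices in which some vertices are doubled
to a pair of non-adjacent twins. -/
structure IsLayering [DecidableEq V] (D : Digraph V) (l : V → Fin k) : Prop where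
  adj_iff : ∀ u v, D.Adj u v ↔ l u < l v
  one_le : ∀ i, 1 ≤ #{v | l v = i}
  le_two : ∀ i, #{v | l v = i} ≤ 2

theorem sum_same_layer [DecidableEq V] (l : V → Fin k) :
    ∑ u, ∑ v, (if l v = l u ∧ u ≠ v then 1 else 0 : ℤ)
      = ∑ i, (#{v | l v = i} : ℤ) * (#{v | l v = i} - 1) := by
  have hrow : ∀ u, ∑ v, (if l v = l u ∧ u ≠ v then 1 else 0 : ℤ) = #{v | l v = l u} - 1 := by
    intro u
    have : ∀ v, (if l v = l u ∧ u ≠ v then 1 else 0 : ℤ)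
        = (if l v = l u then 1 else 0) - if u = v then 1 else 0 := by
      intro v
      by_cases huv : u = v
      · simp [huv]
      · simp [huv]
    simp only [this, Finset.sum_sub_distrib, Finset.sum_boole]
    simp [Finset.filter_eq]
  simp only [hrow]
  rw [← Finset.sum_fiberwise univ l]
  refine Finset.sum_congr rfl fun i _ => ?_
  rw [Finset.sum_congr rfl (g := fun _ => (#{v | l v = i} : ℤ) - 1)
    (fun u hu => by rw [(Finset.mem_filter.1 hu).2]), Finset.sum_const, nsmul_eq_mul]

theorem sum_card_layers (l : V → Fin k) : ∑ i, #{v | l v = i} = Fintype.card V := by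
  rw [← Finset.card_univ, Finset.card_eq_sum_card_fiberwise (f := l) (t := univ) (by simp)]

theorem ten_le_sum_slack {l : V → Fin k} (hl : ∀ u v, D.Adj u v → l u < l v)
    (hV : Fintype.card V = k + 5) : 10 ≤ ∑ u, ∑ v, slack D u v := by
  classical
  calc (10 : ℤ) = ∑ i, 2 * ((#{v | l v = i} : ℤ) - 1) := by
        rw [← Finset.mul_sum, Finset.sum_sub_distrib, ← Nat.cast_sum, sum_card_layers, hV]
        simp
    _ ≤ ∑ i, (#{v | l v = i} : ℤ) * (#{v | l v = i} - 1) := by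
        refine Finset.sum_le_sum fun i _ => ?_
        rcases le_or_gt (#{v | l v = i} : ℤ) 1 with h | h <;> nlinarith
    _ = ∑ u, ∑ v, (if l v = l u ∧ u ≠ v then 1 else 0 : ℤ) := (sum_same_layer l).symm
    _ ≤ _ := Finset.sum_le_sum fun u _ => Finset.sum_le_sum fun v _ => same_le_slack hl u v

/-- Slack at most 10 makes every inequality in the layer count an equality: `(a - 1) (a - 2) = 0`
for each layer size `a`, and no slack between different layers. -/
theorem isLayering_of_sum_slack_le [DecidableEq V] {l : V → Fin k}
    (hl : ∀ u v, D.Adj u v → l u < l v) (hV : Fintype.card V = k + 5)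
    (h10 : ∑ u, ∑ v, slack D u v ≤ 10) : IsLayering D l := by
  have hle : ∑ u, ∑ v, (if l v = l u ∧ u ≠ v then 1 else 0 : ℤ) ≤ ∑ u, ∑ v, slack D u v :=
    Finset.sum_le_sum fun u _ => Finset.sum_le_sum fun v _ => same_le_slack hl u v
  have hterm : ∀ i ∈ (univ : Finset (Fin k)), 2 * ((#{v | l v = i} : ℤ) - 1) ≤
      (#{v | l v = i} : ℤ) * (#{v | l v = i} - 1) := by
    intro i _
    rcases le_or_gt (#{v | l v = i} : ℤ) 1 with h | h <;> nlinarith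
  have hsum : ∑ i, 2 * ((#{v | l v = i} : ℤ) - 1) = 10 := by
    rw [← Finset.mul_sum, Finset.sum_sub_distrib, ← Nat.cast_sum, sum_card_layers, hV]
    simp
  have hle' := Finset.sum_le_sum hterm
  rw [sum_same_layer] at hle
  have hcard := (Finset.sum_eq_sum_iff_of_le hterm).1 (by linarith)
  have hcases : ∀ i, #{v | l v = i} = 1 ∨ #{v | l v = i} = 2 := by
    intro i
    have := hcard i (Finset.mem_univ i)
    have : ((#{v | l v = i} : ℤ) - 1) * (#{v | l v = i} - 2) = 0 := by linarith
    rcases mul_eq_zero.1 this with h | h <;> omega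
  refine ⟨fun u v => ⟨hl u v, fun huv => ?_⟩, fun i => by have := hcases i; omega,
    fun i => by have := hcases i; omega⟩
  rw [← sum_same_layer] at hle
  have heq := (Finset.sum_eq_sum_iff_of_le (fun u _ => Finset.sum_le_sum
    fun v _ => same_le_slack hl u v)).1 (le_antisymm hle (by rw [sum_same_layer]; linarith))
  have := (Finset.sum_eq_sum_iff_of_le (fun v _ => same_le_slack hl u v)).1
    (heq u (Finset.mem_univ u)) v (Finset.mem_univ v)
  rw [if_neg (fun h => huv.ne h.1.symm)] at this
  by_contra hna
  rw [slack_eq_one (fun e => huv.ne (congrArg l e)) hna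
    (fun h => lt_asymm huv (hl _ _ h))] at this
  exact zero_ne_one this

/-- Arcs climb strictly through `k` layers, so there is no walk of length `k` at all. -/
theorem IsLayering.isFree [DecidableEq V] {l : V → Fin k} (h : IsLayering D l) : IsFree D k := by
  rintro ⟨p, -, hp, -⟩
  have : ∀ i : Fin (k + 1), (i : ℕ) ≤ l (p i) := by
    intro i
    induction i using Fin.induction with
    | zero => simp
    | succ i ih =>
      have := Fin.lt_def.1 ((h.adj_iff _ _).1 (hp i))
      simp only [Fin.val_castSucc, Fin.val_succ] at ih ⊢
      omega
  have h1 := this (Fin.last k)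
  rw [Fin.val_last] at h1
  omega

theorem IsLayering.sum_slack [DecidableEq V] {l : V → Fin k} (h : IsLayering D l)
    (hV : Fintype.card V = k + 5) : ∑ u, ∑ v, slack D u v = 10 := by
  have hsame : ∀ u v, slack D u v = if l v = l u ∧ u ≠ v then 1 else 0 := by
    intro u v
    unfold slack arc
    simp only [h.adj_iff]
    rcases lt_trichotomy (l u) (l v) with h' | h' | h'
    · have : u ≠ v := fun e => h'.ne (congrArg l e)
      simp [h', h'.ne', h'.not_gt, this]
    · by_cases huv : u = v <;> simp [h', huv]
    · have : u ≠ v := fun e => h'.ne' (congrArg l e)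
      simp [h', h'.ne, h'.not_gt, this]
  simp only [hsame]
  rw [sum_same_layer]
  calc ∑ i, (#{v | l v = i} : ℤ) * (#{v | l v = i} - 1)
      = ∑ i, 2 * ((#{v | l v = i} : ℤ) - 1) := by
        refine Finset.sum_congr rfl fun i _ => ?_
        have h1 := h.one_le i
        have h2 := h.le_two i
        have : #{v | l v = i} = 1 ∨ #{v | l v = i} = 2 := by omega
        rcases this with h' | h' <;> simp [h']
    _ = 10 := by
        rw [← Finset.mul_sum, Finset.sum_sub_distrib, ← Nat.cast_sum, sum_card_layers, hV]
        simp

/-- The vertices of one layer that remain when the positions `α` of the second block are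
deleted. -/
def remainingLayerEquiv (α : Finset (Fin k)) (i : Fin k) :
    {x : Remaining 1 k α // x.1.2 = i} ≃ {b : Fin 2 // ¬ (b = Fin.last 1 ∧ i ∈ α)} where
  toFun x := ⟨x.1.1.1, fun h => x.1.2 ⟨h.1, by rw [x.2]; exact h.2⟩⟩
  invFun b := ⟨⟨(b.1, i), b.2⟩, rfl⟩
  left_inv := by
    rintro ⟨⟨⟨b, j⟩, hx⟩, rfl⟩
    rfl
  right_inv _ := rfl

/-- An entry of `deleted` depends only on the positions inside the blocks, so the position is the
layer and the block index separates twins. -/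
theorem isCompletelyTransitive_iff [DecidableEq V] (hV : Fintype.card V = k + 5) :
    IsCompletelyTransitive D 1 k 5 ↔ ∃ l : V → Fin k, IsLayering D l := by
  have hentry : ∀ (α : Finset (Fin k)) (x y : Remaining 1 k α),
      deleted 1 k α x y = if x.1.2 < y.1.2 then 1 else 0 := by
    intro α x y
    simp [deleted, Pi', J, T, Matrix.kroneckerMap_apply]
  constructor
  · rintro ⟨α, -, e, he⟩
    refine ⟨fun v => (e v).1.2, fun u v => ?_, fun i => ?_, fun i => ?_⟩
    · have := congrFun (congrFun he u) v
      rw [Matrix.submatrix_apply, hentry] at this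
      simp only [adjMatrix, Matrix.of_apply] at this
      by_cases h1 : D.Adj u v <;> by_cases h2 : (e u).1.2 < (e v).1.2 <;> simp_all
    · refine Finset.card_pos.2 ⟨e.symm ⟨(0, i), fun h => ?_⟩, by simp⟩
      exact (show (0 : Fin 2) ≠ Fin.last 1 by decide) h.1
    · refine (Finset.card_le_card_of_injOn (t := (univ : Finset (Fin 2))) (fun v => (e v).1.1)
        (by simp) ?_).trans (by simp)
      intro u hu v hv huv
      rw [Finset.mem_coe, Finset.mem_filter] at hu hv
      exact e.injective (Subtype.ext (Prod.ext huv (hu.2.trans hv.2.symm)))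
  · rintro ⟨l, hl⟩
    -- The deleted positions are the layers without a twin; counting vertices gives `k + 5 + #α = 2
    -- k`.
    set α : Finset (Fin k) := {i | #{v | l v = i} = 1} with hα
    have hcases : ∀ i, #{v | l v = i} = if i ∈ α then 1 else 2 := by
      intro i
      have h1 := hl.one_le i
      have h2 := hl.le_two i
      simp only [hα, Finset.mem_filter, Finset.mem_univ, true_and]
      split_ifs <;> omega
    have hcard : #α + 5 = k := by
      have h1 := sum_card_layers l
      have h2 : ∑ i, (#{v | l v = i} + if i ∈ α then 1 else 0) = ∑ _i : Fin k, 2 := by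
        refine Finset.sum_congr rfl fun i _ => ?_
        rw [hcases i]
        split_ifs <;> rfl
      rw [Finset.sum_add_distrib, h1, hV, Finset.sum_const, Finset.card_univ, Fintype.card_fin,
        Finset.sum_boole, Finset.filter_univ_mem] at h2
      simp only [Nat.cast_id, smul_eq_mul] at h2
      omega
    have hfib : ∀ i, Nonempty ({v // l v = i} ≃ {x : Remaining 1 k α // x.1.2 = i}) := by
      intro i
      have h1 : Fintype.card {v // l v = i}
          = Fintype.card {b : Fin 2 // ¬ (b = Fin.last 1 ∧ i ∈ α)} := by
        rw [Fintype.card_subtype, hcases i, Fintype.card_subtype]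
        by_cases hi : i ∈ α
        · simp only [hi, if_true, and_true]
          decide
        · simp [hi]
      exact ⟨(Fintype.equivOfCardEq h1).trans (remainingLayerEquiv α i).symm⟩
    let f := fun i => (hfib i).some
    refine ⟨α, hcard, Equiv.ofFiberEquiv f, ?_⟩
    ext u v
    have hmap : ∀ v, ((Equiv.ofFiberEquiv f) v).1.2 = l v := fun v => Equiv.ofFiberEquiv_map f v
    rw [Matrix.submatrix_apply, hentry, hmap, hmap]
    simp only [adjMatrix, Matrix.of_apply, hl.adj_iff]

theorem exists_isLayering (hk : 5 ≤ k) :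
    ∃ (D : Digraph (Fin (k + 5))) (l : Fin (k + 5) → Fin k), IsLayering D l := by
  -- As `k + 5 ≤ 2 k`, each residue modulo `k` occurs once or twice.
  let l : Fin (k + 5) → Fin k := fun v => ⟨v % k, Nat.mod_lt _ (by omega)⟩
  refine ⟨⟨fun u v => l u < l v⟩, l, fun _ _ => Iff.rfl, fun i => ?_, fun i => ?_⟩
  · refine Finset.card_pos.2 ⟨⟨i, by omega⟩, ?_⟩
    simp [l, Fin.ext_iff, Nat.mod_eq_of_lt]
  · refine (Finset.card_le_card (t := {⟨i, by omega⟩, Fin.ofNat (k + 5) (i + k)}) fun v hv => ?_).trans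
      Finset.card_le_two
    have hv' : (v : ℕ) % k = i := by simpa [l, Fin.ext_iff] using hv
    rw [Finset.mem_insert, Finset.mem_singleton, Fin.ext_iff, Fin.ext_iff]
    rcases Nat.lt_or_ge v k with h | h
    · rw [Nat.mod_eq_of_lt h] at hv'
      exact Or.inl hv'
    · right
      rw [Nat.mod_eq_sub_mod h, Nat.mod_eq_of_lt (by omega)] at hv'
      have hi : (i : ℕ) + k = v := by omega
      simp [Fin.ofNat, hi, Nat.mod_eq_of_lt v.2]

/-- The extremal bound together with its equality case. -/
theorem IsFree.ten_le_sum_slack [DecidableEq V] (h : IsFree D k) (hk : 5 ≤ k)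
    (hV : Fintype.card V = k + 5) :
    10 ≤ ∑ u, ∑ v, slack D u v ∧
      (∑ u, ∑ v, slack D u v = 10 → ∃ l : V → Fin k, IsLayering D l) := by
  by_cases hwf : WellFounded D.Adj
  · obtain ⟨lev, hlev⟩ := exists_isLevel hwf
    by_cases hlong : ∃ v, k ≤ lev v
    · obtain ⟨v, hv⟩ := hlong
      have := hlev.le_sum_slack h hk hV hv
      exact ⟨by omega, fun h' => by omega⟩
    · push Not at hlong
      have hl : ∀ u v, D.Adj u v → (⟨lev u, hlong u⟩ : Fin k) < ⟨lev v, hlong v⟩ :=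
        fun u v huv => hlev.lt huv
      exact ⟨TuranWalk.ten_le_sum_slack (l := fun v => ⟨lev v, hlong v⟩) hl hV,
        fun h' => ⟨_, isLayering_of_sum_slack_le hl hV h'.le⟩⟩
  · have := le_sum_slack_of_not_wellFounded h hk (by omega) hwf
    rw [hV] at this
    push_cast at this
    exact ⟨by omega, fun h' => by omega⟩

theorem ex_add_five (hk : 5 ≤ k) : ex (k + 5) k = (k + 5) * (k + 4) / 2 - 5 := by
  have key : ∀ D : Digraph (Fin (k + 5)),
      (∑ u, ∑ v, slack D u v : ℤ) = ((k : ℤ) + 5) * (k + 4) - 2 * size D := by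
    intro D
    rw [sum_slack, Fintype.card_fin]
    push_cast
    ring
  have hcast : (((k + 5) * (k + 4) : ℕ) : ℤ) = ((k : ℤ) + 5) * (k + 4) := by push_cast; ring
  have hcard : Fintype.card (Fin (k + 5)) = k + 5 := Fintype.card_fin _
  obtain ⟨⟨D, hD, hsize⟩, hub⟩ := isGreatest_ex (k + 5) k
  obtain ⟨D', l, hl⟩ := exists_isLayering hk
  -- An optimal digraph has slack at least 10, and a layered one attains 10.
  have h1 := (hD.ten_le_sum_slack hk hcard).1
  have h2 := hub ⟨D', hl.isFree, rfl⟩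
  have h3 := hl.sum_slack hcard
  rw [key] at h1 h3
  omega

end Layers

end TuranWalk

/-! ### The extremal number and the extremal digraphs. -/

theorem lemma4p1 (n : ℕ) (hn : 10 ≤ n) :
    TuranWalk.ex n (n - 5) = n * (n - 1) / 2 - 5 ∧
      ∀ D : Digraph (Fin n),
        D ∈ TuranWalk.Ex n (n - 5) ↔ TuranWalk.IsCompletelyTransitive D 1 (n - 5) 5 := by
  obtain ⟨k, rfl⟩ : ∃ k, n = k + 5 := ⟨n - 5, by omega⟩
  have hk : 5 ≤ k := by omega
  have hcard : Fintype.card (Fin (k + 5)) = k + 5 := Fintype.card_fin _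
  rw [Nat.add_sub_cancel, show k + 5 - 1 = k + 4 by omega]
  refine ⟨TuranWalk.ex_add_five hk, fun D => ?_⟩
  have hslack := TuranWalk.sum_slack D
  rw [hcard] at hslack
  have hcast : (((k + 5) * (k + 4) : ℕ) : ℤ) = ((k + 5 : ℕ) : ℤ) * ((k + 5 : ℕ) - 1) := by
    push_cast
    ring
  -- This bound and the parity below make the natural-number division and subtraction exact, so that
  -- extremal size is the same as slack 10.
  have hsq : 90 ≤ (k + 5) * (k + 4) := Nat.mul_le_mul (show 10 ≤ k + 5 by omega)
    (show 9 ≤ k + 4 by omega)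
  have heven : 2 ∣ (k + 5) * (k + 4) := by
    rw [mul_comm]
    exact (Nat.even_mul_succ_self (k + 4)).two_dvd
  rw [TuranWalk.isCompletelyTransitive_iff hcard]
  constructor
  · rintro ⟨hfree, hsize⟩
    rw [TuranWalk.ex_add_five hk] at hsize
    exact (hfree.ten_le_sum_slack hk hcard).2 (by omega)
  · rintro ⟨l, hl⟩
    have h10 := hl.sum_slack hcard
    refine ⟨hl.isFree, ?_⟩
    rw [TuranWalk.ex_add_five hk]
    omega
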